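/- Let $\beta>0$ be real and let $X_1,\dots,X_n$ be independent real random variables such that $\mathbb E X_i\le 0$ for all $i$, $\sum_{i=1}^n\mathbb E X_i^2\le 1$ and $\sum_{i=1}^n\mathbb E (X_i)_+^3\le\beta$, where $x_+:=\max(0,x)$ and $x_+^p:=(x_+)^p$. Put $S:=X_1+\dots+X_n$ and let $Z$ be a standard normal random variable. Then for any $p\in(0,3)$ and any real $a>0$, \[ \mathbb E S_+^p\le\frac{p^p(3-p)^{3-p}}{3^3}\cdot\frac{\mathbb E(Z+a)_+^3+\beta}{a^{3-p}}. \] In particular, $\mathbb E S_+\le 0.514+0.0486\,\beta$ and $\mathbb E S_+^2\le 0.555+0.232\,\beta$. -/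

import Mathlib

open MeasureTheory ProbabilityTheory

/-! Lindeberg replacement with the test function `f x = max 0 x ^ 3`, where `f'' = 6 * max 0 ·` is
nondecreasing, 6-Lipschitz and convex. Monotonicity and the Lipschitz bound make the second-order
Taylor remainder at most `max 0 x ^ 3`; convexity makes the second-order expansion a lower bound
under a centred Gaussian. So replacing `X i` by a Gaussian of variance `E (X i)^2` costs at most `E
(X i)_+^3`, uniformly in the shift `u`, and the costs add under convolution
(`integral_pos_part_cube_sum_le`).

A multiple of `max 0 (x + a) ^ 3` dominates `max 0 x ^ p` by weighted AM-GM (`pos_part_rpow_le`),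
which gives the general bound. The numerical cases use an explicit upper bound for `E (Z + a)_+^3`.
-/

/-! ### Pointwise inequalities for the cubed positive part -/

lemma pos_part_add_cube_le_taylor (u x : ℝ) :
    max 0 (u + x) ^ 3 ≤
      max 0 u ^ 3 + 3 * max 0 u ^ 2 * x + 3 * max 0 u * x ^ 2 + max 0 x ^ 3 := by
  rcases le_total u 0 with hu | hu
  · rw [max_eq_left hu]
    have : max 0 (u + x) ≤ max 0 x := max_le_max le_rfl (by linarith)
    have := pow_le_pow_left₀ (le_max_left 0 (u + x)) this 3
    linarith
  · rw [max_eq_right hu]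
    rcases le_total (u + x) 0 with h | h
    · rw [max_eq_left h]
      have h2 : 0 ≤ max 0 x ^ 3 := by positivity
      have h3 : 0 ≤ u * (u ^ 2 + 3 * u * x + 3 * x ^ 2) :=
        mul_nonneg hu (by nlinarith [sq_nonneg (u + x), sq_nonneg (u + 2 * x), sq_nonneg x])
      nlinarith
    · rw [max_eq_right h]
      have h2 : x ^ 3 ≤ max 0 x ^ 3 := by
        rcases le_total x 0 with hx | hx
        · rw [max_eq_left hx]
          have : 0 ≤ (-x) ^ 3 := pow_nonneg (by linarith) 3
          nlinarith
        · rw [max_eq_right hx]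
      nlinarith

/-- Convexity of `f''` gives `f''(u + t) + f''(u - t) ≥ 2 f''(u)`; integrate twice. Symmetrizing
removes the odd terms. -/
lemma taylor_le_pos_part_cube_symmetrized (u y : ℝ) :
    2 * max 0 u ^ 3 + 6 * max 0 u * y ^ 2 ≤ max 0 (u + y) ^ 3 + max 0 (u + -y) ^ 3 := by
  rcases le_total u 0 with hu | hu
  · rw [max_eq_left hu]
    have h1 : 0 ≤ max 0 (u + y) ^ 3 := by positivity
    have h2 : 0 ≤ max 0 (u + -y) ^ 3 := by positivity
    linarith
  · rw [max_eq_right hu]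
    wlog hy : 0 ≤ y generalizing y
    · have := this (-y) (by linarith)
      rw [neg_neg, neg_sq] at this
      linarith
    rw [max_eq_right (by linarith : 0 ≤ u + y)]
    rcases le_total (u + -y) 0 with h | h
    · rw [max_eq_left h]
      have : 0 ≤ (y - u) ^ 3 := pow_nonneg (by linarith) 3
      nlinarith
    · rw [max_eq_right h]
      nlinarith

lemma pos_part_add_cube_le (x y : ℝ) :
    max 0 (x + y) ^ 3 ≤ 4 * (max 0 x ^ 3 + max 0 y ^ 3) := by
  have h : max 0 (x + y) ≤ max 0 x + max 0 y :=
    max_le (by positivity) (add_le_add (le_max_right _ _) (le_max_right _ _))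
  calc max 0 (x + y) ^ 3 ≤ (max 0 x + max 0 y) ^ 3 := pow_le_pow_left₀ (le_max_left _ _) h 3
    _ ≤ 4 * (max 0 x ^ 3 + max 0 y ^ 3) := by
        have hx := le_max_left 0 x
        have hy := le_max_left 0 y
        generalize max 0 x = s at *
        generalize max 0 y = t at *
        nlinarith [mul_nonneg (add_nonneg hx hy) (sq_nonneg (s - t))]

/-! ### Integrability -/

lemma MeasureTheory.Integrable.pos_part_add_cube {Ω : Type*} [MeasurableSpace Ω] {P : Measure Ω} {X Y : Ω → ℝ}
    (hX : Measurable X) (hY : Measurable Y)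
    (hX3 : Integrable (fun ω => max 0 (X ω) ^ 3) P)
    (hY3 : Integrable (fun ω => max 0 (Y ω) ^ 3) P) :
    Integrable (fun ω => max 0 (X ω + Y ω) ^ 3) P := by
  refine ((hX3.add hY3).const_mul 4).mono' (by fun_prop) (.of_forall fun ω => ?_)
  rw [Real.norm_of_nonneg (by positivity)]
  exact pos_part_add_cube_le _ _

lemma MeasureTheory.Integrable.pos_part_const_add_cube {μ : Measure ℝ} [IsFiniteMeasure μ]
    (h : Integrable (fun x => max 0 x ^ 3) μ) (u : ℝ) :
    Integrable (fun x => max 0 (u + x) ^ 3) μ :=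
  Integrable.pos_part_add_cube measurable_const measurable_id (integrable_const _) h

lemma integrable_pos_part_cube_gaussianReal (m : ℝ) (v : NNReal) :
    Integrable (fun x => max 0 x ^ 3) (gaussianReal m v) := by
  have h : Integrable (fun x => ‖(id x : ℝ)‖ ^ 3) (gaussianReal m v) :=
    MemLp.integrable_norm_pow (p := 3) (by exact_mod_cast memLp_id_gaussianReal (μ := m) (v := v) 3)
      (by norm_num)
  refine h.mono' (by fun_prop) (.of_forall fun x => ?_)
  rw [Real.norm_of_nonneg (by positivity)]
  exact pow_le_pow_left₀ (le_max_left _ _) (max_le (norm_nonneg _) (le_abs_self x)) 3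

lemma integrable_pos_part_cube_conv {μ ν : Measure ℝ} [IsProbabilityMeasure μ]
    [IsProbabilityMeasure ν] (hμ : Integrable (fun x => max 0 x ^ 3) μ)
    (hν : Integrable (fun x => max 0 x ^ 3) ν) :
    Integrable (fun x => max 0 x ^ 3) (μ ∗ ν) := by
  rw [Measure.conv, integrable_map_measure (by fun_prop) (by fun_prop)]
  exact Integrable.pos_part_add_cube measurable_fst measurable_snd (hμ.comp_fst ν) (hν.comp_snd μ)

/-! ### Comparing one summand with a Gaussian -/

lemma integral_pos_part_cube_le_taylor {μ : Measure ℝ} [IsProbabilityMeasure μ]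
    (h2 : MemLp id 2 μ) (h3 : Integrable (fun x => max 0 x ^ 3) μ) (h1 : ∫ x, x ∂μ ≤ 0) (u : ℝ) :
    ∫ x, max 0 (u + x) ^ 3 ∂μ ≤
      max 0 u ^ 3 + 3 * max 0 u * ∫ x, x ^ 2 ∂μ + ∫ x, max 0 x ^ 3 ∂μ := by
  have i1 : Integrable (fun x : ℝ => x) μ := h2.integrable (by norm_num)
  have i2 : Integrable (fun x : ℝ => x ^ 2) μ := h2.integrable_sq
  have j1 : Integrable (fun x : ℝ => 3 * max 0 u ^ 2 * x) μ := i1.const_mul _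
  have j2 : Integrable (fun x : ℝ => 3 * max 0 u * x ^ 2) μ := i2.const_mul _
  have j0 : Integrable (fun _ : ℝ => max 0 u ^ 3) μ := integrable_const _
  have key := integral_mono (h3.pos_part_const_add_cube u) (((j0.add j1).add j2).add h3)
    (fun x => pos_part_add_cube_le_taylor u x)
  have e : ∫ x, ((((fun _ : ℝ => max 0 u ^ 3) + (fun x : ℝ => 3 * max 0 u ^ 2 * x)) +
      (fun x : ℝ => 3 * max 0 u * x ^ 2) + (fun x : ℝ => max 0 x ^ 3) : ℝ → ℝ)) x ∂μ =
      max 0 u ^ 3 + 3 * max 0 u ^ 2 * ∫ x, x ∂μ + 3 * max 0 u * ∫ x, x ^ 2 ∂μ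
        + ∫ x, max 0 x ^ 3 ∂μ := by
    rw [integral_add' ((j0.add j1).add j2) h3, integral_add' (j0.add j1) j2, integral_add' j0 j1,
      integral_const_mul, integral_const_mul]
    simp
  rw [e] at key
  -- A nonpositive mean suffices because `f' ≥ 0`.
  have : 3 * max 0 u ^ 2 * ∫ x, x ∂μ ≤ 0 := mul_nonpos_of_nonneg_of_nonpos (by positivity) h1
  linarith

lemma integral_sq_gaussianReal_zero (v : NNReal) : ∫ x, x ^ 2 ∂gaussianReal 0 v = v := by
  have h := variance_fun_id_gaussianReal (μ := 0) (v := v)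
  rw [variance_eq_integral measurable_id'.aemeasurable] at h
  simpa [integral_id_gaussianReal] using h

lemma taylor_le_integral_pos_part_cube_gaussianReal (v : NNReal) (u : ℝ) :
    max 0 u ^ 3 + 3 * max 0 u * v ≤ ∫ x, max 0 (u + x) ^ 3 ∂gaussianReal 0 v := by
  have hi := (integrable_pos_part_cube_gaussianReal 0 v).pos_part_const_add_cube u
  have hneg : (gaussianReal 0 v).map (fun x => -x) = gaussianReal 0 v := by
    rw [gaussianReal_map_neg, neg_zero]
  have hi' : Integrable (fun x => max 0 (u + -x) ^ 3) (gaussianReal 0 v) := by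
    rw [← hneg] at hi
    exact (integrable_map_measure (by fun_prop) (by fun_prop)).1 hi
  have hs : ∫ x, max 0 (u + -x) ^ 3 ∂gaussianReal 0 v = ∫ x, max 0 (u + x) ^ 3 ∂gaussianReal 0 v := by
    conv_rhs => rw [← hneg]
    rw [integral_map (by fun_prop) (by fun_prop)]
  have i2 : Integrable (fun x : ℝ => x ^ 2) (gaussianReal 0 v) :=
    (memLp_id_gaussianReal (μ := 0) (v := v) 2).integrable_sq
  have key := integral_mono ((integrable_const (2 * max 0 u ^ 3)).add (i2.const_mul (6 * max 0 u)))
    (hi.add hi') (fun x => taylor_le_pos_part_cube_symmetrized u x)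
  rw [integral_add' hi hi', hs, integral_add' (integrable_const _) (i2.const_mul _),
    integral_const_mul (6 * max 0 u), integral_sq_gaussianReal_zero] at key
  simp only [integral_const, probReal_univ, one_smul] at key
  linarith

/-! ### Lindeberg replacement through convolutions -/

lemma integral_pos_part_cube_conv {μ ν : Measure ℝ} [IsProbabilityMeasure μ]
    [IsProbabilityMeasure ν] (hμ : Integrable (fun x => max 0 x ^ 3) μ)
    (hν : Integrable (fun x => max 0 x ^ 3) ν) (u : ℝ) :
    Integrable (fun x => ∫ y, max 0 (u + x + y) ^ 3 ∂ν) μ ∧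
    ∫ x, max 0 (u + x) ^ 3 ∂(μ ∗ ν) = ∫ x, ∫ y, max 0 (u + x + y) ^ 3 ∂ν ∂μ := by
  have h := (integrable_pos_part_cube_conv hμ hν).pos_part_const_add_cube u
  refine ⟨?_, ?_⟩
  · have h' : Integrable (fun x => ∫ y, ‖max 0 (u + (x + y)) ^ 3‖ ∂ν) μ :=
      ((integrable_conv_iff (by fun_prop)).1 h).2
    refine h'.congr (.of_forall fun x => ?_)
    refine integral_congr_ae (.of_forall fun y => ?_)
    simp only [add_assoc]
    rw [Real.norm_of_nonneg (by positivity)]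
  · rw [integral_conv h]
    simp only [add_assoc]

lemma integral_pos_part_cube_conv_le {μ ν γ δ : Measure ℝ} [IsProbabilityMeasure μ]
    [IsProbabilityMeasure ν] [IsProbabilityMeasure γ] [IsProbabilityMeasure δ]
    (hμ : Integrable (fun x => max 0 x ^ 3) μ) (hν : Integrable (fun x => max 0 x ^ 3) ν)
    (hγ : Integrable (fun x => max 0 x ^ 3) γ) (hδ : Integrable (fun x => max 0 x ^ 3) δ)
    {b c : ℝ}
    (hμγ : ∀ u, ∫ x, max 0 (u + x) ^ 3 ∂μ ≤ ∫ x, max 0 (u + x) ^ 3 ∂γ + b)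
    (hνδ : ∀ u, ∫ x, max 0 (u + x) ^ 3 ∂ν ≤ ∫ x, max 0 (u + x) ^ 3 ∂δ + c) (u : ℝ) :
    ∫ x, max 0 (u + x) ^ 3 ∂(μ ∗ ν) ≤ ∫ x, max 0 (u + x) ^ 3 ∂(γ ∗ δ) + (b + c) := by
  obtain ⟨i1, e1⟩ := integral_pos_part_cube_conv hμ hν u
  obtain ⟨i2, e2⟩ := integral_pos_part_cube_conv hμ hδ u
  -- The factors are swapped so that the measure being replaced is the inner one: the path is `μ ∗
  -- ν`, `μ ∗ δ = δ ∗ μ`, `δ ∗ γ`.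
  obtain ⟨i3, e3⟩ := integral_pos_part_cube_conv hδ hμ u
  obtain ⟨i4, e4⟩ := integral_pos_part_cube_conv hδ hγ u
  have s1 := integral_mono i1 (i2.add (integrable_const c)) fun x => hνδ (u + x)
  have s2 := integral_mono i3 (i4.add (integrable_const b)) fun x => hμγ (u + x)
  rw [integral_add' i2 (integrable_const c), ← e1, ← e2] at s1
  rw [integral_add' i4 (integrable_const b), ← e3, ← e4] at s2
  rw [Measure.conv_comm δ μ, Measure.conv_comm δ γ] at s2
  simp only [integral_const, probReal_univ, one_smul] at s1 s2
  linarith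

lemma integral_pos_part_cube_le_gaussianReal {μ : Measure ℝ} [IsProbabilityMeasure μ]
    (h2 : MemLp id 2 μ) (h3 : Integrable (fun x => max 0 x ^ 3) μ) (h1 : ∫ x, x ∂μ ≤ 0) (u : ℝ) :
    ∫ x, max 0 (u + x) ^ 3 ∂μ ≤
      ∫ x, max 0 (u + x) ^ 3 ∂gaussianReal 0 (∫ x, x ^ 2 ∂μ).toNNReal + ∫ x, max 0 x ^ 3 ∂μ := by
  have h := taylor_le_integral_pos_part_cube_gaussianReal (∫ x, x ^ 2 ∂μ).toNNReal u
  rw [Real.coe_toNNReal _ (integral_nonneg fun x => sq_nonneg x)] at h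
  linarith [integral_pos_part_cube_le_taylor h2 h3 h1 u]

/-- The larger Gaussian is the smaller one plus independent centred noise, which can only raise the
mean of a convex function. -/
lemma integral_pos_part_cube_gaussianReal_mono {v w : NNReal} (h : v ≤ w) (u : ℝ) :
    ∫ x, max 0 (u + x) ^ 3 ∂gaussianReal 0 v ≤ ∫ x, max 0 (u + x) ^ 3 ∂gaussianReal 0 w := by
  have e : gaussianReal 0 w = gaussianReal 0 v ∗ gaussianReal 0 (w - v) := by
    rw [gaussianReal_conv_gaussianReal, add_zero, add_tsub_cancel_of_le h]
  have hv := integrable_pos_part_cube_gaussianReal 0 v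
  obtain ⟨i, eq⟩ := integral_pos_part_cube_conv hv (integrable_pos_part_cube_gaussianReal 0 (w - v)) u
  rw [e, eq]
  refine integral_mono (hv.pos_part_const_add_cube u) i fun x => ?_
  refine le_trans ?_ (taylor_le_integral_pos_part_cube_gaussianReal (w - v) (u + x))
  have : 0 ≤ 3 * max 0 (u + x) * ((w - v : NNReal) : ℝ) := by positivity
  simpa using this

theorem integral_pos_part_cube_sum_le {Ω ι : Type*} [MeasurableSpace Ω] {P : Measure Ω}
    [IsProbabilityMeasure P] {X : ι → Ω → ℝ} (hmeas : ∀ i, Measurable (X i))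
    (hindep : iIndepFun X P) (hL2 : ∀ i, MemLp (X i) 2 P)
    (hL3 : ∀ i, Integrable (fun ω => max 0 (X i ω) ^ 3) P)
    (hmean : ∀ i, ∫ ω, X i ω ∂P ≤ 0) (s : Finset ι) :
    Integrable (fun x => max 0 x ^ 3) (P.map (∑ i ∈ s, X i)) ∧
    ∀ u, ∫ x, max 0 (u + x) ^ 3 ∂P.map (∑ i ∈ s, X i) ≤
      ∫ x, max 0 (u + x) ^ 3 ∂gaussianReal 0 (∑ i ∈ s, (∫ ω, X i ω ^ 2 ∂P).toNNReal) +
        ∑ i ∈ s, ∫ ω, max 0 (X i ω) ^ 3 ∂P := by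
  classical
  induction s using Finset.induction_on with
  | empty =>
    have : P.map (0 : Ω → ℝ) = Measure.dirac 0 := by
      have h := Measure.map_const P (0 : ℝ)
      rwa [measure_univ, one_smul] at h
    simp only [Finset.sum_empty, this, gaussianReal_zero_var, add_zero, le_refl, implies_true,
      and_true]
    exact integrable_dirac (by simp)
  | insert i s hi ih =>
    obtain ⟨ih3, ih⟩ := ih
    have hSm : Measurable (∑ j ∈ s, X j) := by fun_prop
    have : IsProbabilityMeasure (P.map (∑ j ∈ s, X j)) :=
      Measure.isProbabilityMeasure_map hSm.aemeasurable
    have : IsProbabilityMeasure (P.map (X i)) :=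
      Measure.isProbabilityMeasure_map (hmeas i).aemeasurable
    have e : P.map (∑ j ∈ insert i s, X j) = P.map (X i) ∗ P.map (∑ j ∈ s, X j) := by
      rw [Finset.sum_insert hi]
      exact (hindep.indepFun_finsetSum_of_notMem hmeas hi).symm.map_add_eq_map_conv_map
        (hmeas i) hSm
    have c3 : Integrable (fun x => max 0 x ^ 3) (P.map (X i)) :=
      (integrable_map_measure (by fun_prop) (hmeas i).aemeasurable).2 (hL3 i)
    have c2 : MemLp id 2 (P.map (X i)) :=
      (memLp_map_measure_iff (by fun_prop) (hmeas i).aemeasurable).2 (hL2 i)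
    have c1 : ∫ x, x ∂P.map (X i) ≤ 0 := by
      rw [integral_map (hmeas i).aemeasurable (by fun_prop)]
      exact hmean i
    have hcmp := integral_pos_part_cube_le_gaussianReal c2 c3 c1
    rw [integral_map (f := fun x => x ^ 2) (hmeas i).aemeasurable (by fun_prop),
      integral_map (f := fun x => max 0 x ^ 3) (hmeas i).aemeasurable (by fun_prop)] at hcmp
    rw [e, Finset.sum_insert hi, Finset.sum_insert hi]
    refine ⟨integrable_pos_part_cube_conv c3 ih3, fun u => ?_⟩
    have key := integral_pos_part_cube_conv_le c3 ih3 (integrable_pos_part_cube_gaussianReal 0 _)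
      (integrable_pos_part_cube_gaussianReal 0 _) hcmp ih u
    rwa [gaussianReal_conv_gaussianReal, add_zero] at key

/-! ### From the third moment to the `p`-th -/

lemma pos_part_rpow_le {p a : ℝ} (hp : 0 < p) (hp3 : p < 3) (ha : 0 < a) (x : ℝ) :
    max 0 x ^ p ≤
      p ^ p * (3 - p) ^ (3 - p) / 3 ^ 3 * (max 0 (x + a) ^ 3 / a ^ (3 - p)) := by
  have hq : 0 < 3 - p := by linarith
  rcases le_total x 0 with hx | hx
  · rw [max_eq_left hx, Real.zero_rpow hp.ne']
    positivity
  rw [max_eq_right hx, max_eq_right (by positivity)]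
  -- These points make the arithmetic mean exactly `(x + a) / 3`; equality holds at `x = p * a / (3
  -- - p)`.
  have h := Real.geom_mean_le_arith_mean2_weighted (w₁ := p / 3) (w₂ := (3 - p) / 3)
    (p₁ := x / p) (p₂ := a / (3 - p)) (by positivity) (by positivity) (by positivity)
    (by positivity) (by ring)
  have h' : (x / p) ^ (p / 3) * (a / (3 - p)) ^ ((3 - p) / 3) ≤ (x + a) / 3 := by
    refine h.trans_eq ?_
    field_simp
  have h3 := pow_le_pow_left₀ (by positivity) h' 3
  rw [mul_pow, ← Real.rpow_mul_natCast (by positivity), ← Real.rpow_mul_natCast (by positivity)] at h3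
  push_cast at h3
  rw [div_mul_cancel₀ _ (by norm_num), div_mul_cancel₀ _ (by norm_num),
    Real.div_rpow hx hp.le, Real.div_rpow ha.le hq.le] at h3
  have e1 : 0 < p ^ p := by positivity
  have e2 : 0 < (3 - p) ^ (3 - p) := by positivity
  have e3 : 0 < a ^ (3 - p) := by positivity
  rw [div_mul_div_comm, div_le_iff₀ (by positivity)] at h3
  rw [div_mul_div_comm, le_div_iff₀ (by positivity)]
  rw [div_pow] at h3
  nlinarith

/-! ### Explicit bounds for the shifted Gaussian moment -/

lemma exp_neg_le_quadratic {x : ℝ} (hx : 0 ≤ x) : Real.exp (-x) ≤ 1 - x + x ^ 2 / 2 := by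
  have h := Real.quadratic_le_exp_of_nonneg hx
  rw [Real.exp_neg]
  refine (inv_anti₀ (by positivity) h).trans ?_
  rw [inv_le_iff_one_le_mul₀ (by positivity)]
  -- `(1 - x + x^2/2) * (1 + x + x^2/2) = 1 + x^4/4`.
  nlinarith [pow_nonneg hx 4]

lemma integral_cube_sub_mul_quartic (a : ℝ) :
    ∫ z in (0 : ℝ)..a, (1 - z ^ 2 / 2 + z ^ 4 / 8) * (a - z) ^ 3 =
      a ^ 4 / 4 - a ^ 6 / 120 + a ^ 8 / 2240 := by
  have h : ∀ z ∈ Set.uIcc 0 a, HasDerivAt (fun z : ℝ => a ^ 3 * z ^ 1 - 3 * a ^ 2 / 2 * z ^ 2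
      + (a - a ^ 3 / 6) * z ^ 3 + (-1 / 4 + 3 * a ^ 2 / 8) * z ^ 4
      + (a ^ 3 / 40 - 3 * a / 10) * z ^ 5 + (1 / 12 - a ^ 2 / 16) * z ^ 6 + 3 * a / 56 * z ^ 7
      - 1 / 64 * z ^ 8) ((1 - z ^ 2 / 2 + z ^ 4 / 8) * (a - z) ^ 3) z := by
    intro z _
    have hd := fun (c : ℝ) (k : ℕ) => (hasDerivAt_pow k z).const_mul c
    refine ((((((((hd (a ^ 3) 1).sub (hd (3 * a ^ 2 / 2) 2)).add (hd (a - a ^ 3 / 6) 3)).add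
      (hd (-1 / 4 + 3 * a ^ 2 / 8) 4)).add (hd (a ^ 3 / 40 - 3 * a / 10) 5)).add
      (hd (1 / 12 - a ^ 2 / 16) 6)).add (hd (3 * a / 56) 7)).sub (hd (1 / 64) 8)).congr_deriv ?_
    push_cast
    ring
  rw [intervalIntegral.integral_eq_sub_of_hasDerivAt h
    (Continuous.intervalIntegrable (by fun_prop) _ _)]
  ring

lemma integral_Ioi_pow_mul_exp_neg_sq_half (k : ℕ) :
    IntegrableOn (fun x : ℝ => x ^ k * Real.exp (-x ^ 2 / 2)) (Set.Ioi 0) ∧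
    ∫ x in Set.Ioi (0 : ℝ), x ^ k * Real.exp (-x ^ 2 / 2) =
      (1 / 2 : ℝ) ^ (-((k : ℝ) + 1) / 2) * (1 / 2) * Real.Gamma ((k + 1) / 2) := by
  have e : ∀ x : ℝ, x ^ (k : ℝ) * Real.exp (-(1 / 2) * x ^ (2 : ℝ)) =
      x ^ k * Real.exp (-x ^ 2 / 2) := by
    intro x
    rw [Real.rpow_natCast, Real.rpow_two]
    ring_nf
  refine ⟨?_, ?_⟩
  · have := integrable_rpow_mul_exp_neg_mul_sq (b := 1 / 2) (by norm_num) (s := k)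
      (by have := Nat.cast_nonneg (α := ℝ) k; linarith)
    simp only [Real.rpow_natCast, show ∀ x : ℝ, -(1 / 2) * x ^ 2 = -x ^ 2 / 2 by intro x; ring]
      at this
    exact this.integrableOn
  · rw [← integral_rpow_mul_exp_neg_mul_rpow (p := 2) (q := k) (b := 1 / 2) (by norm_num)
      (by have := Nat.cast_nonneg (α := ℝ) k; linarith) (by norm_num)]
    simp only [e]

lemma integral_Ioi_cube_add_mul_exp (a : ℝ) :
    IntegrableOn (fun x : ℝ => Real.exp (-x ^ 2 / 2) * (x + a) ^ 3) (Set.Ioi 0) ∧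
    ∫ x in Set.Ioi (0 : ℝ), Real.exp (-x ^ 2 / 2) * (x + a) ^ 3 =
      2 + 3 * a ^ 2 + √(2 * Real.pi) * (3 * a / 2 + a ^ 3 / 2) := by
  obtain ⟨i0, e0⟩ := integral_Ioi_pow_mul_exp_neg_sq_half 0
  obtain ⟨i1, e1⟩ := integral_Ioi_pow_mul_exp_neg_sq_half 1
  obtain ⟨i2, e2⟩ := integral_Ioi_pow_mul_exp_neg_sq_half 2
  obtain ⟨i3, e3⟩ := integral_Ioi_pow_mul_exp_neg_sq_half 3
  have g : √(2 * Real.pi) = √2 * √Real.pi := Real.sqrt_mul (by norm_num) _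
  have r2 : (1 / 2 : ℝ) ^ (-(1 / 2) : ℝ) = √2 := by
    rw [Real.sqrt_eq_rpow, Real.rpow_neg (by norm_num), ← Real.inv_rpow (by norm_num)]
    norm_num
  have r3 : (1 / 2 : ℝ) ^ (-(3 / 2) : ℝ) = 2 * √2 := by
    rw [show (-(3 / 2) : ℝ) = -1 + -(1 / 2) by norm_num, Real.rpow_add (by norm_num), r2,
      Real.rpow_neg_one]
    norm_num
  have f0 : ∫ x in Set.Ioi (0 : ℝ), x ^ 0 * Real.exp (-x ^ 2 / 2) = √(2 * Real.pi) / 2 := by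
    rw [e0, g, show (((0 : ℕ) : ℝ) + 1) / 2 = 1 / 2 by norm_num, Real.Gamma_one_half_eq,
      show (-(((0 : ℕ) : ℝ) + 1) / 2) = -(1 / 2) by norm_num, r2]
    ring
  have f1 : ∫ x in Set.Ioi (0 : ℝ), x ^ 1 * Real.exp (-x ^ 2 / 2) = 1 := by
    rw [e1]
    norm_num [Real.rpow_neg_one]
  have f2 : ∫ x in Set.Ioi (0 : ℝ), x ^ 2 * Real.exp (-x ^ 2 / 2) = √(2 * Real.pi) / 2 := by
    rw [e2, g, show (((2 : ℕ) : ℝ) + 1) / 2 = 1 / 2 + 1 by norm_num, Real.Gamma_add_one (by norm_num),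
      Real.Gamma_one_half_eq, show (-(((2 : ℕ) : ℝ) + 1) / 2) = -(3 / 2) by norm_num, r3]
    ring
  have f3 : ∫ x in Set.Ioi (0 : ℝ), x ^ 3 * Real.exp (-x ^ 2 / 2) = 2 := by
    rw [e3, show (((3 : ℕ) : ℝ) + 1) / 2 = 2 by norm_num,
      show (-(((3 : ℕ) : ℝ) + 1) / 2) = ((-2 : ℤ) : ℝ) by norm_num, Real.Gamma_two,
      Real.rpow_intCast]
    norm_num
  have E : (fun x : ℝ => Real.exp (-x ^ 2 / 2) * (x + a) ^ 3) = fun x =>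
      x ^ 3 * Real.exp (-x ^ 2 / 2) + 3 * a * (x ^ 2 * Real.exp (-x ^ 2 / 2)) +
      3 * a ^ 2 * (x ^ 1 * Real.exp (-x ^ 2 / 2)) + a ^ 3 * (x ^ 0 * Real.exp (-x ^ 2 / 2)) := by
    ext x; ring
  have j2 := i2.const_mul (3 * a)
  have j1 := i1.const_mul (3 * a ^ 2)
  have j0 := i0.const_mul (a ^ 3)
  rw [E]
  refine ⟨((i3.add j2).add j1).add j0, ?_⟩
  rw [integral_add (by exact (i3.add j2).add j1) j0, integral_add (by exact i3.add j2) j1,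
    integral_add i3 j2,
    integral_const_mul, integral_const_mul, integral_const_mul, f0, f1, f2, f3]
  ring

/-- The half-line `z > 0` is integrated exactly. The rest lives on `[-a, 0]`, where the density is
bounded by a quartic polynomial. -/
lemma integral_pos_part_cube_gaussianReal_le {a : ℝ} (ha : 0 < a) :
    ∫ z, max 0 (z + a) ^ 3 ∂gaussianReal 0 1 ≤
      (√(2 * Real.pi))⁻¹ * (2 + 3 * a ^ 2 + a ^ 4 / 4 - a ^ 6 / 120 + a ^ 8 / 2240)
        + 3 * a / 2 + a ^ 3 / 2 := by
  set c := √(2 * Real.pi) with hc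
  have c0 : 0 < c := Real.sqrt_pos.2 (by positivity)
  set f : ℝ → ℝ := fun z => Real.exp (-z ^ 2 / 2) * max 0 (z + a) ^ 3 with hf
  have e : ∫ z, max 0 (z + a) ^ 3 ∂gaussianReal 0 1 = c⁻¹ * ∫ z, f z := by
    rw [integral_gaussianReal_eq_integral_smul (by norm_num), ← integral_const_mul]
    refine integral_congr_ae (.of_forall fun z => ?_)
    simp [gaussianPDFReal_def, hf, hc, mul_assoc]
  obtain ⟨ipos, epos⟩ := integral_Ioi_cube_add_mul_exp a
  have fpos : ∀ z ∈ Set.Ioi (0 : ℝ), Real.exp (-z ^ 2 / 2) * (z + a) ^ 3 = f z := by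
    intro z hz
    simp only [hf]
    rw [max_eq_right (by have : 0 < z := hz; positivity)]
  have ipos' : IntegrableOn f (Set.Ioi 0) := ipos.congr_fun fpos measurableSet_Ioi
  have epos' : ∫ z in Set.Ioi 0, f z = 2 + 3 * a ^ 2 + c * (3 * a / 2 + a ^ 3 / 2) := by
    rw [← setIntegral_congr_fun measurableSet_Ioi fpos, epos]
  have fz : ∀ z, f (-z) ≠ 0 → z < a := by
    intro z hz
    by_contra! h
    exact hz (by simp only [hf]; rw [max_eq_left (by linarith)]; simp)
  have hcont : Continuous f := by fun_prop
  have eneg : ∫ z in Set.Iic 0, f z = ∫ z in (0 : ℝ)..a, f (-z) := by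
    have h := integral_comp_neg_Ioi 0 f
    rw [neg_zero] at h
    rw [← h, intervalIntegral.integral_of_le ha.le]
    refine (setIntegral_eq_of_subset_of_forall_sdiff_eq_zero measurableSet_Ioi
      Set.Ioc_subset_Ioi_self fun z hz => ?_)
    by_contra h0
    exact hz.2 ⟨hz.1, (fz z h0).le⟩
  have ineg : IntegrableOn f (Set.Iic 0) := by
    have h1 : IntegrableOn f (Set.Icc (-a) 0) := hcont.continuousOn.integrableOn_Icc
    refine h1.of_forall_sdiff_eq_zero measurableSet_Iic fun z hz => ?_
    by_contra h0
    have := fz (-z) (by rwa [neg_neg])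
    exact hz.2 ⟨by linarith, hz.1⟩
  have hneg : ∫ z in (0 : ℝ)..a, f (-z) ≤ a ^ 4 / 4 - a ^ 6 / 120 + a ^ 8 / 2240 := by
    rw [← integral_cube_sub_mul_quartic]
    refine intervalIntegral.integral_mono_on ha.le
      (Continuous.intervalIntegrable (by fun_prop) _ _)
      (Continuous.intervalIntegrable (by fun_prop) _ _) fun z hz => ?_
    simp only [hf]
    rw [max_eq_right (by linarith [hz.2]), show -z + a = a - z by ring]
    refine mul_le_mul_of_nonneg_right ?_ (pow_nonneg (by linarith [hz.2]) 3)
    have := exp_neg_le_quadratic (x := z ^ 2 / 2) (by positivity)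
    rw [show -(-z) ^ 2 / 2 = -(z ^ 2 / 2) by ring]
    linarith [this, show (z ^ 2 / 2) ^ 2 / 2 = z ^ 4 / 8 by ring]
  have htot : ∫ z, f z = (∫ z in Set.Iic 0, f z) + ∫ z in Set.Ioi 0, f z :=
    (intervalIntegral.integral_Iic_add_Ioi ineg ipos').symm
  rw [e, htot, epos', eneg]
  calc c⁻¹ * ((∫ z in (0 : ℝ)..a, f (-z)) + (2 + 3 * a ^ 2 + c * (3 * a / 2 + a ^ 3 / 2)))
      ≤ c⁻¹ * ((a ^ 4 / 4 - a ^ 6 / 120 + a ^ 8 / 2240) +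
          (2 + 3 * a ^ 2 + c * (3 * a / 2 + a ^ 3 / 2))) := by gcongr
    _ = _ := by field_simp; ring

lemma inv_sqrt_two_mul_pi_le : (√(2 * Real.pi))⁻¹ ≤ 0.39908 := by
  have h : (2.506 : ℝ) ≤ √(2 * Real.pi) :=
    Real.le_sqrt_of_sq_le (by nlinarith [Real.pi_gt_d4])
  exact (inv_anti₀ (by norm_num) h).trans (by norm_num)

/-! ### The moment bounds -/

theorem corollary1 {Ω : Type*} [MeasurableSpace Ω] (P : Measure Ω) [IsProbabilityMeasure P]
    (n : ℕ) (X : Fin n → Ω → ℝ) (β : ℝ) (hβ : 0 < β)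
    (hmeas : ∀ i, Measurable (X i))
    (hindep : iIndepFun X P)
    (hL2 : ∀ i, MemLp (X i) 2 P)
    (hL3 : ∀ i, Integrable (fun ω => max 0 (X i ω) ^ 3) P)
    (hmean : ∀ i, ∫ ω, X i ω ∂P ≤ 0)
    (hvar : ∑ i, ∫ ω, X i ω ^ 2 ∂P ≤ 1)
    (hthird : ∑ i, ∫ ω, max 0 (X i ω) ^ 3 ∂P ≤ β) :
    (∀ p : ℝ, 0 < p → p < 3 → ∀ a : ℝ, 0 < a →
      Integrable (fun ω => max 0 (∑ i, X i ω) ^ p) P ∧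
      Integrable (fun z : ℝ => max 0 (z + a) ^ 3) (gaussianReal 0 1) ∧
      ∫ ω, max 0 (∑ i, X i ω) ^ p ∂P ≤
        p ^ p * (3 - p) ^ (3 - p) / 3 ^ 3 *
          (((∫ z : ℝ, max 0 (z + a) ^ 3 ∂(gaussianReal 0 1)) + β) / a ^ (3 - p))) ∧
    (Integrable (fun ω => max 0 (∑ i, X i ω)) P ∧
      ∫ ω, max 0 (∑ i, X i ω) ∂P ≤ 0.514 + 0.0486 * β) ∧
    (Integrable (fun ω => max 0 (∑ i, X i ω) ^ 2) P ∧
      ∫ ω, max 0 (∑ i, X i ω) ^ 2 ∂P ≤ 0.555 + 0.232 * β) := by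
  obtain ⟨hint, hle⟩ :=
    integral_pos_part_cube_sum_le hmeas hindep hL2 hL3 hmean Finset.univ
  have hSm : Measurable (∑ i, X i) := by fun_prop
  have hvar' : ∑ i, (∫ ω, X i ω ^ 2 ∂P).toNNReal ≤ 1 := by
    rw [← NNReal.coe_le_coe]
    push_cast
    refine le_trans (le_of_eq (Finset.sum_congr rfl fun i _ => ?_)) hvar
    exact Real.coe_toNNReal _ (integral_nonneg fun ω => sq_nonneg _)
  have hprob : IsProbabilityMeasure (P.map (∑ i, X i)) :=
    Measure.isProbabilityMeasure_map hSm.aemeasurable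
  have hint' : ∀ a : ℝ, Integrable (fun ω => max 0 (∑ i, X i ω + a) ^ 3) P := by
    intro a
    have h := (integrable_map_measure (by fun_prop) hSm.aemeasurable).1
      (hint.pos_part_const_add_cube a)
    refine h.congr (.of_forall fun ω => ?_)
    simp [add_comm]
  have hcube : ∀ a : ℝ, ∫ ω, max 0 (∑ i, X i ω + a) ^ 3 ∂P ≤
      (∫ z : ℝ, max 0 (z + a) ^ 3 ∂(gaussianReal 0 1)) + β := by
    intro a
    have h1 := hle a
    have h2 := integral_pos_part_cube_gaussianReal_mono hvar' a
    rw [integral_map hSm.aemeasurable (by fun_prop)] at h1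
    simp only [Finset.sum_apply, add_comm a] at h1 h2
    linarith
  have main : ∀ p : ℝ, 0 < p → p < 3 → ∀ a : ℝ, 0 < a →
      Integrable (fun ω => max 0 (∑ i, X i ω) ^ p) P ∧
      Integrable (fun z : ℝ => max 0 (z + a) ^ 3) (gaussianReal 0 1) ∧
      ∫ ω, max 0 (∑ i, X i ω) ^ p ∂P ≤
        p ^ p * (3 - p) ^ (3 - p) / 3 ^ 3 *
          (((∫ z : ℝ, max 0 (z + a) ^ 3 ∂(gaussianReal 0 1)) + β) / a ^ (3 - p)) := by
    intro p hp hp3 a ha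
    have hq : 0 < 3 - p := by linarith
    have hdom := ((hint' a).div_const (a ^ (3 - p))).const_mul
      (p ^ p * (3 - p) ^ (3 - p) / 3 ^ 3)
    have hSm' : Measurable fun ω => ∑ i, X i ω := by fun_prop
    have hp_int : Integrable (fun ω => max 0 (∑ i, X i ω) ^ p) P := by
      refine hdom.mono' ((measurable_const.max hSm').pow_const p).aestronglyMeasurable
        (.of_forall fun ω => ?_)
      rw [Real.norm_of_nonneg (by positivity)]
      exact pos_part_rpow_le hp hp3 ha _
    refine ⟨hp_int, ?_, ?_⟩
    · simpa only [add_comm a] using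
        (integrable_pos_part_cube_gaussianReal 0 1).pos_part_const_add_cube a
    · refine (integral_mono hp_int hdom fun ω => pos_part_rpow_le hp hp3 ha _).trans ?_
      rw [integral_const_mul, integral_div]
      have := hcube a
      gcongr
  refine ⟨main, ?_, ?_⟩
  -- The coefficient of `β` is `4 / (27 * a^2)`, just below 0.0486 for this `a`; the constant term
  -- fits 0.514 only narrowly.
  · obtain ⟨i, -, h⟩ := main 1 (by norm_num) (by norm_num) 1.746 (by norm_num)
    simp only [Real.rpow_one] at i h
    refine ⟨i, h.trans ?_⟩
    have hg := integral_pos_part_cube_gaussianReal_le (a := 1.746) (by norm_num)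
    have hc := inv_sqrt_two_mul_pi_le
    rw [show (3 - 1 : ℝ) = 2 by norm_num, Real.rpow_two, Real.rpow_two]
    norm_num at hg hc ⊢
    linarith
  -- Here the coefficient of `β` is `4 / (27 * a)`, about 0.2315.
  · obtain ⟨i, -, h⟩ := main 2 (by norm_num) (by norm_num) 0.64 (by norm_num)
    simp only [Real.rpow_two] at i h
    refine ⟨i, h.trans ?_⟩
    have hg := integral_pos_part_cube_gaussianReal_le (a := 0.64) (by norm_num)
    have hc := inv_sqrt_two_mul_pi_le
    rw [show (3 - 2 : ℝ) = 1 by norm_num, Real.rpow_one, Real.rpow_one]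
    norm_num at hg hc ⊢
    linarith
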